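/- Conventions. A simplicial complex is finite and is identified with its poset of faces, including the empty face $\emptyset$ (of dimension $-1$); it has rank $n$ (dimension $n-1$) if every face lies in a face with exactly $n$ vertices and no face has more. Write $|x|$ for the number of vertices of a face $x$, $\operatorname{Link}_\Delta(x)=\{y : y\cap x=\emptyset,\ y\cup x\in\Delta\}$ (so $\operatorname{Link}_\Delta(\emptyset)=\Delta$), and $\widetilde H_i$ for reduced simplicial homology. A complex $\Delta$ of rank $n$ is Gorenstein (a real homology sphere) if for every face $x\in\Delta$, including $x=\emptyset$, $\widetilde H_i(\operatorname{Link}_\Delta(x),\mathbb R)\cong\mathbb R$ for $i=n-1-|x|$ and $=0$ for all other $i$. A pair $(\Delta,\partial\Delta)$, with $\Delta$ a complex of rank $n$ and $\partial\Delta\subset\Delta$ a subcomplex, is near-Gorenstein of rank $n$ (a real homology ball with boundary $\partial\Delta$) if $\partial\Delta$ is Gorenstein of rank $n-1$ and for every face $x\in\Delta$, including $x=\emptyset$, $\widetilde H_i(\operatorname{Link}_\Delta(x),\mathbb R)\cong\mathbb R$ if $i=n-1-|x|$ and $x\notin\partial\Delta$, and $=0$ in all other cases. Put $\operatorname{Int}\Delta=\Delta\smallsetminus\partial\Delta$.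 Posets are finite, with minimal element $\hat 0$, and graded; a poset has rank $n$ if all its maximal elements have rank $n$, where $\hat 0$ has rank $0$. The order complex $\mathcal O(\Pi)$ is the complex of chains in $\Pi\smallsetminus\{\hat 0\}$. A poset $\Pi$ of rank $n$ is Gorenstein* if $\mathcal O(\Pi)$ is Gorenstein of rank $n$. A pair $(\Pi,\partial\Pi)$, with $\Pi$ of rank $n$ and $\partial\Pi\subset\Pi$ an ideal ($\sigma\in\partial\Pi$, $\tau\in\Pi$, $\tau<\sigma$ imply $\tau\in\partial\Pi$) of rank $n-1$, is near-Gorenstein* of rank $n$ if $(\mathcal O(\Pi),\mathcal O(\partial\Pi))$ is near-Gorenstein of rank $n$. Put $\operatorname{Int}\Pi=\Pi\smallsetminus\partial\Pi$. Proposition. Let $\Delta$ be a Gorenstein simplicial complex of rank $n$ and let $\Delta_1\subset\Delta$ be a subcomplex such that $(\Delta_1,\partial\Delta_1)$ is near-Gorenstein of the same rank $n$. Then $\Delta_2=\Delta\smallsetminus\operatorname{Int}\Delta_1$ is a subcomplex of $\Delta$, and the complementary pair $(\Delta_2,\partial\Delta_1)$ is also near-Gorenstein of rank $n$. Corollary.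 Let $\Pi$ be a Gorenstein* poset of rank $n$ and let $\Pi_1\subset\Pi$ be a sub-poset containing $\hat 0$ (the minimal element of $\Pi$) such that $(\Pi_1,\partial\Pi_1)$ is near-Gorenstein* of the same rank $n$, where $\hat 0\in\partial\Pi_1$ as well. Then the complementary pair $(\Pi\smallsetminus\operatorname{Int}\Pi_1,\partial\Pi_1)$ is also near-Gorenstein* of rank $n$. -/

import Mathlib

noncomputable section

open scoped Classical in
/-- The incidence sign `(-1) ^ #{w ∈ s | w < v}` of the vertex `v` of the simplex `s`. Simplices are
oriented by an auxiliary total order of the vertices (up to isomorphism, homology does not depend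
on it); we use the well-order of Mathlib, which exists on every type. -/
def incidenceSign (k : Type*) [Field k] {V : Type*} (s : Finset V) (v : V) : k :=
  (-1) ^ (s.filter fun w => WellOrderingRel w v).card

open scoped Classical in
/-- The simplicial boundary `∂ s = ∑ v ∈ s, ± (s \ {v})`, on formal linear combinations, with
coefficients in the field `k`, of finite sets of vertices. The empty simplex is allowed, so this is
the augmented boundary map: `∂ {v} = ∅` and `∂ ∅ = 0`. -/
def simplicialBoundary (k : Type*) [Field k] (V : Type*) :
    (Finset V →₀ k) →ₗ[k] (Finset V →₀ k) :=
  Finsupp.linearCombination k fun s : Finset V =>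
    ∑ v ∈ s, Finsupp.single (s.erase v) (incidenceSign k s v)

/-- The quotient `Z / (Z ∩ B)` of submodules. -/
abbrev Subquotient {R M : Type*} [Ring R] [AddCommGroup M] [Module R M] (Z B : Submodule R M) :
    Type _ :=
  Z ⧸ B.submoduleOf Z

namespace PreAbstractSimplicialComplex

variable {V : Type*}

/-- The face poset of the complex: all faces, together with the empty face `∅` of dimension `-1`
(the minimal element of the poset). The rank of a face is its number of vertices. -/
def augFaces (K : PreAbstractSimplicialComplex V) : Set (Finset V) :=
  insert ∅ K.faces

/-- `K` is a complex of rank `n`, i.e. of dimension `n - 1`, where complexes are graded posets whose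
maximal elements all have rank `n`: every face lies in a face with `n` vertices. -/
def HasRank (K : PreAbstractSimplicialComplex V) (n : ℤ) : Prop :=
  ∀ s ∈ K.augFaces, ∃ t ∈ K.augFaces, s ⊆ t ∧ (t.card : ℤ) = n

open scoped Classical in
/-- The link of `x` in `K`: the faces that are disjoint from `x` and span a face together with
`x`. The link of the empty face is `K`. -/
def link (K : PreAbstractSimplicialComplex V) (x : Finset V) : PreAbstractSimplicialComplex V where
  faces := {s | s.Nonempty ∧ Disjoint s x ∧ s ∪ x ∈ K.faces}
  isRelLowerSet_faces := by
    rintro s ⟨hs, hd, hu⟩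
    refine ⟨hs, fun t hts ht => ⟨ht, Finset.disjoint_of_subset_left hts hd, ?_⟩⟩
    exact (K.isRelLowerSet_faces hu).2 (Finset.union_subset_union_left hts)
      (ht.mono Finset.subset_union_left)

/-- The augmented simplicial `i`-chains: combinations of the faces of dimension `i`, for
`i ≥ -1`. -/
def chains (k : Type*) [Field k] (K : PreAbstractSimplicialComplex V) (i : ℤ) :
    Submodule k (Finset V →₀ k) :=
  Finsupp.supported k k {s | s ∈ K.augFaces ∧ (s.card : ℤ) = i + 1}

/-- The `i`-cycles of the augmented chain complex. -/
def cycles (k : Type*) [Field k] (K : PreAbstractSimplicialComplex V) (i : ℤ) :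
    Submodule k (Finset V →₀ k) :=
  K.chains k i ⊓ LinearMap.ker (simplicialBoundary k V)

/-- The `i`-boundaries of the augmented chain complex. -/
def boundaries (k : Type*) [Field k] (K : PreAbstractSimplicialComplex V) (i : ℤ) :
    Submodule k (Finset V →₀ k) :=
  (K.chains k (i + 1)).map (simplicialBoundary k V)

/-- The reduced simplicial homology `H̃_i(K, k)`: cycles modulo boundaries. -/
abbrev ReducedHomology (k : Type*) [Field k] (K : PreAbstractSimplicialComplex V) (i : ℤ) :
    Type _ :=
  Subquotient (K.cycles k i) (K.boundaries k i)

/-- `K` is Gorenstein of rank `n` over the field `k` (a homology sphere of dimension `n - 1`, real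
if `k = ℝ`): for every face `x`, including the empty one, the reduced homology of the link of `x` is
`k` in degree `(n - 1) - |x|` (the dimension of the link) and `0` in all other degrees. -/
structure IsGorenstein (k : Type*) [Field k] (K : PreAbstractSimplicialComplex V) (n : ℤ) : Prop where
  hasRank : K.HasRank n
  homology_top : ∀ x ∈ K.augFaces, ∀ i : ℤ, i = n - 1 - x.card →
    Nonempty ((K.link x).ReducedHomology k i ≃ₗ[k] k)
  homology_zero : ∀ x ∈ K.augFaces, ∀ i : ℤ, i ≠ n - 1 - x.card →
    Subsingleton ((K.link x).ReducedHomology k i)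

/-- The pair `(K, B)` is near-Gorenstein of rank `n` over the field `k` (`K` is a homology ball of
dimension `n - 1`, real if `k = ℝ`, with boundary `B`): `B` is a Gorenstein subcomplex of
rank `n - 1`, and for every face `x` of `K`, including the empty one, the reduced homology of the
link of `x` is `k` in degree `(n - 1) - |x|` if `x` is not in `B`, and `0` in all other cases. -/
structure IsNearGorenstein (k : Type*) [Field k] (K B : PreAbstractSimplicialComplex V) (n : ℤ) :
    Prop where
  hasRank : K.HasRank n
  boundary_le : B ≤ K
  boundary_isGorenstein : B.IsGorenstein k (n - 1)
  homology_top : ∀ x ∈ K.augFaces, ∀ i : ℤ, (i = n - 1 - x.card ∧ x ∉ B.augFaces) →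
    Nonempty ((K.link x).ReducedHomology k i ≃ₗ[k] k)
  homology_zero : ∀ x ∈ K.augFaces, ∀ i : ℤ, ¬ (i = n - 1 - x.card ∧ x ∉ B.augFaces) →
    Subsingleton ((K.link x).ReducedHomology k i)

/-- The interior of the pair `(K, B)`: the set of faces of `K` that are not in `B`. -/
def interior (K B : PreAbstractSimplicialComplex V) : Set (Finset V) :=
  K.augFaces \ B.augFaces

end PreAbstractSimplicialComplex

section Posets

variable {P : Type*} [PartialOrder P] [OrderBot P]

/-- The subset `S` of `P`, with the induced order, is a graded poset of rank `n` with minimal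
element `⊥`: it has a rank function, which is `0` at the minimal element and `n` at all maximal
elements. -/
def IsPosetOfRank (S : Set P) (n : ℤ) : Prop :=
  ⊥ ∈ S ∧ ∃ _ : GradeMinOrder ℕ S, ∀ a : S, IsMax a → (grade ℕ a : ℤ) = n

/-- The order complex of the subposet `S` of `P`: its faces are the finite chains of elements of
`S` different from the minimal element `⊥`. -/
def orderComplex (S : Set P) : PreAbstractSimplicialComplex P where
  faces := {s | s.Nonempty ∧ (s : Set P) ⊆ S ∧ ⊥ ∉ s ∧ IsChain (· ≤ ·) (s : Set P)}
  isRelLowerSet_faces := by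
    rintro s ⟨hs, hS, hb, hc⟩
    exact ⟨hs, fun t hts ht => ⟨ht, fun a ha => hS (hts ha), fun h => hb (hts h),
      hc.mono (fun a ha => hts ha)⟩⟩

/-- The poset `S` is Gorenstein* of rank `n`: its order complex is Gorenstein over `ℝ`. -/
structure IsGorensteinStar (S : Set P) (n : ℤ) : Prop where
  isPosetOfRank : IsPosetOfRank S n
  isGorenstein : (orderComplex S).IsGorenstein ℝ n

/-- The pair `(S, B)` of subposets of `P` is near-Gorenstein* of rank `n`: `S` has rank `n`, `B` is
an ideal of `S` of rank `n - 1`, and the pair of order complexes is near-Gorenstein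
over `ℝ`. -/
structure IsNearGorensteinStar (S B : Set P) (n : ℤ) : Prop where
  isPosetOfRank : IsPosetOfRank S n
  boundary_isPosetOfRank : IsPosetOfRank B (n - 1)
  boundary_subset : B ⊆ S
  boundary_ideal : ∀ a ∈ B, ∀ b ∈ S, b < a → b ∈ B
  isNearGorenstein : (orderComplex S).IsNearGorenstein ℝ (orderComplex B) n

end Posets

end

/-! The engine is rigidity of top cycles: in a homology sphere, a nonzero top-degree cycle of the
link of any face has nonzero coefficient on every facet of that link
(`IsGorenstein.apply_ne_zero_of_mem_cycles`). It is proved by induction on the dimension of the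
link: contracting at a vertex gives a cycle of a smaller link, and connectedness of the link carries
nonvanishing from one vertex to the next.

Rigidity has two uses. At a face `x` interior to the ball `K₁`, the link in `K₁` carries a top
cycle, so it is the whole link in `K`; hence the interior is closed upwards and its complement `K₂`
is a subcomplex. At a face of `B`, the link in `K₂` carries no top cycle, since otherwise a facet of
`K₁` would lie in `K₂`, hence in `B`, which has smaller dimension. Links in `K₂` of faces outside
`B` agree with those in `K`. For a face of `B`, the Mayer–Vietoris argument of
`subsingleton_reducedHomology_of_union` gives acyclicity.

For posets, the order complex of the complement is the complement of the order complexes, again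
because the interior is closed upwards. Gradedness follows from purity of that order complex; that
`B` is an ideal of the whole poset (`IsNearGorensteinStar.mem_boundary_of_lt`) follows from rigidity
applied to chains below an element of `B`. -/

noncomputable section

/-! ### Vertex contractions and the simplicial boundary map -/

section Contraction

variable {k V : Type*} [Field k]

open scoped Classical in
lemma incidenceSign_ne_zero (s : Finset V) (v : V) : incidenceSign k s v ≠ 0 :=
  pow_ne_zero _ (neg_ne_zero.mpr one_ne_zero)

open scoped Classical in
lemma incidenceSign_singleton (v : V) : incidenceSign k {v} v = 1 := by
  have : ({v} : Finset V).filter (fun w => WellOrderingRel w v) = ∅ := by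
    ext w
    simp only [Finset.mem_filter, Finset.mem_singleton, Finset.notMem_empty, iff_false, not_and]
    rintro rfl
    exact irrefl _
  simp [incidenceSign, this]

open scoped Classical in
-- Removing the smaller vertex `v` shifts the position of `w` by one, while removing `w` leaves that
-- of `v` unchanged.
lemma incidenceSign_mul_erase_of_rel {s : Finset V} {v w : V} (hv : v ∈ s)
    (h : WellOrderingRel v w) :
    incidenceSign k s v * incidenceSign k (s.erase v) w =
      -(incidenceSign k s w * incidenceSign k (s.erase w) v) := by
  have h1 : (s.erase w).filter (fun u => WellOrderingRel u v) =
      s.filter (fun u => WellOrderingRel u v) := by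
    ext u
    simp only [Finset.mem_filter, Finset.mem_erase]
    refine ⟨fun hu => ⟨hu.1.2, hu.2⟩, fun hu => ⟨⟨?_, hu.1⟩, hu.2⟩⟩
    rintro rfl
    exact asymm h hu.2
  have h2 : (s.filter (fun u => WellOrderingRel u w)).card =
      ((s.erase v).filter (fun u => WellOrderingRel u w)).card + 1 := by
    rw [Finset.filter_erase, Finset.card_erase_add_one (Finset.mem_filter.mpr ⟨hv, h⟩)]
  simp only [incidenceSign, h1, h2, pow_succ]
  ring

open scoped Classical in
lemma incidenceSign_mul_erase {s : Finset V} {v w : V} (hv : v ∈ s) (hw : w ∈ s) (h : v ≠ w) :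
    incidenceSign k s v * incidenceSign k (s.erase v) w =
      -(incidenceSign k s w * incidenceSign k (s.erase w) v) := by
  rcases trichotomous_of WellOrderingRel v w with h' | h' | h'
  · exact incidenceSign_mul_erase_of_rel hv h'
  · exact absurd h' h
  · rw [incidenceSign_mul_erase_of_rel hw h', neg_neg]

open scoped Classical in
/-- The part of the simplicial boundary that removes the vertex `v`. On the chains of a complex it
takes values in the chains of the link of `v`. -/
def vertexContraction (k : Type*) [Field k] {V : Type*} (v : V) :
    (Finset V →₀ k) →ₗ[k] (Finset V →₀ k) :=
  Finsupp.linearCombination k fun s : Finset V =>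
    if v ∈ s then Finsupp.single (s.erase v) (incidenceSign k s v) else 0

open scoped Classical in
lemma vertexContraction_single_of_mem {s : Finset V} {v : V} (h : v ∈ s) :
    vertexContraction k v (Finsupp.single s 1) =
      incidenceSign k s v • Finsupp.single (s.erase v) 1 := by
  simp [vertexContraction, h]

lemma vertexContraction_single_of_notMem {s : Finset V} {v : V} (h : v ∉ s) :
    vertexContraction k v (Finsupp.single s 1) = 0 := by
  simp [vertexContraction, h]

open scoped Classical in
-- Only `t` contributes to this coefficient, so contraction loses no information about the simplices
-- through `v`.
lemma vertexContraction_apply_erase (z : Finset V →₀ k) {t : Finset V} {v : V} (h : v ∈ t) :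
    vertexContraction k v z (t.erase v) = incidenceSign k t v * z t := by
  induction z using Finsupp.induction_linear with
  | zero => simp
  | add f g hf hg => simp [hf, hg, mul_add]
  | single s a =>
    rw [← mul_one a, ← smul_eq_mul, ← Finsupp.smul_single, map_smul]
    by_cases hs : v ∈ s
    · rw [vertexContraction_single_of_mem hs]
      by_cases hst : s = t
      · subst hst; simp [mul_comm]
      · have : s.erase v ≠ t.erase v := fun he => hst (by
          rw [← Finset.insert_erase hs, he, Finset.insert_erase h])
        simp [hst, this]
    · have : s ≠ t := by rintro rfl; exact hs h
      rw [vertexContraction_single_of_notMem hs]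
      simp [this]

open scoped Classical in
lemma vertexContraction_mem_supported {A B : Set (Finset V)} {v : V}
    (h : ∀ s ∈ A, v ∈ s → s.erase v ∈ B) {z : Finset V →₀ k} (hz : z ∈ Finsupp.supported k k A) :
    vertexContraction k v z ∈ Finsupp.supported k k B := by
  rw [vertexContraction, Finsupp.linearCombination_apply]
  refine Submodule.sum_mem _ fun s hs => Submodule.smul_mem _ _ ?_
  split_ifs with hv
  · exact Finsupp.single_mem_supported k _ (h s (hz hs) hv)
  · exact zero_mem _

lemma finsupp_linearMap_ext {M : Type*} [AddCommGroup M] [Module k M]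
    {f g : (Finset V →₀ k) →ₗ[k] M}
    (h : ∀ s, f (Finsupp.single s 1) = g (Finsupp.single s 1)) : f = g :=
  Finsupp.lhom_ext' fun s => LinearMap.ext_ring (h s)

open scoped Classical in
lemma vertexContraction_comp_self (v : V) :
    vertexContraction k v ∘ₗ vertexContraction k v = 0 := by
  refine finsupp_linearMap_ext fun s => ?_
  by_cases h : v ∈ s
  · rw [LinearMap.comp_apply, vertexContraction_single_of_mem h, map_smul,
      vertexContraction_single_of_notMem (s.notMem_erase v), smul_zero, LinearMap.zero_apply]
  · simp [vertexContraction_single_of_notMem h]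

open scoped Classical in
lemma vertexContraction_anticomm (v w : V) :
    vertexContraction k v ∘ₗ vertexContraction k w =
      -(vertexContraction k w ∘ₗ vertexContraction k v) := by
  by_cases hvw : v = w
  · rw [hvw, vertexContraction_comp_self]
    exact LinearMap.ext fun _ => neg_zero.symm
  refine finsupp_linearMap_ext fun s => ?_
  simp only [LinearMap.comp_apply, LinearMap.neg_apply]
  by_cases hv : v ∈ s <;> by_cases hw : w ∈ s
  · rw [vertexContraction_single_of_mem hv, vertexContraction_single_of_mem hw, map_smul, map_smul,
      vertexContraction_single_of_mem (Finset.mem_erase.mpr ⟨hvw, hv⟩),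
      vertexContraction_single_of_mem (Finset.mem_erase.mpr ⟨Ne.symm hvw, hw⟩), smul_smul,
      smul_smul, incidenceSign_mul_erase hv hw hvw, Finset.erase_right_comm, neg_smul, neg_neg]
  · rw [vertexContraction_single_of_mem hv, vertexContraction_single_of_notMem hw, map_smul,
      vertexContraction_single_of_notMem (by simp [hw])]
    simp
  · rw [vertexContraction_single_of_mem hw, vertexContraction_single_of_notMem hv, map_smul,
      vertexContraction_single_of_notMem (by simp [hv])]
    simp
  · simp [vertexContraction_single_of_notMem hv, vertexContraction_single_of_notMem hw]

/-- The free choice of `T` lets the boundary of a simplex and that of its faces be summed over one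
vertex set, although `V` may be infinite. -/
lemma simplicialBoundary_single {s T : Finset V} (h : s ⊆ T) :
    simplicialBoundary k V (Finsupp.single s 1) =
      ∑ v ∈ T, vertexContraction k v (Finsupp.single s 1) := by
  classical
  rw [← Finset.sum_subset h fun v _ hv => vertexContraction_single_of_notMem hv,
    simplicialBoundary, Finsupp.linearCombination_single, one_smul]
  refine Finset.sum_congr rfl fun v hv => ?_
  rw [vertexContraction_single_of_mem hv, Finsupp.smul_single, smul_eq_mul, mul_one]

lemma simplicialBoundary_comp_vertexContraction (v : V) :
    simplicialBoundary k V ∘ₗ vertexContraction k v =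
      -(vertexContraction k v ∘ₗ simplicialBoundary k V) := by
  classical
  refine finsupp_linearMap_ext fun s => ?_
  have h1 : simplicialBoundary k V (vertexContraction k v (Finsupp.single s 1)) =
      ∑ w ∈ s, vertexContraction k w (vertexContraction k v (Finsupp.single s 1)) := by
    by_cases hv : v ∈ s
    · rw [vertexContraction_single_of_mem hv, map_smul,
        simplicialBoundary_single (s.erase_subset v), Finset.smul_sum]
      simp only [map_smul]
    · simp [vertexContraction_single_of_notMem hv]
  simp only [LinearMap.comp_apply, LinearMap.neg_apply]
  rw [h1, simplicialBoundary_single subset_rfl, map_sum, ← Finset.sum_neg_distrib]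
  exact Finset.sum_congr rfl fun w _ => LinearMap.congr_fun (vertexContraction_anticomm w v) _

/-- Squares vanish and cross terms cancel in pairs; as nothing is divided by `2`, the characteristic
is arbitrary. -/
lemma sum_vertexContraction_comp_self (T : Finset V) :
    (∑ v ∈ T, vertexContraction k v) ∘ₗ (∑ v ∈ T, vertexContraction k v) = 0 := by
  classical
  induction T using Finset.induction_on with
  | empty => simp
  | insert a T ha ih =>
    have h : vertexContraction k a ∘ₗ (∑ v ∈ T, vertexContraction k v) =
        -((∑ v ∈ T, vertexContraction k v) ∘ₗ vertexContraction k a) := by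
      refine LinearMap.ext fun z => ?_
      simp only [LinearMap.comp_apply, LinearMap.neg_apply, LinearMap.sum_apply, map_sum]
      rw [← Finset.sum_neg_distrib]
      exact Finset.sum_congr rfl fun w _ => LinearMap.congr_fun (vertexContraction_anticomm a w) z
    rw [Finset.sum_insert ha, LinearMap.add_comp, LinearMap.comp_add, LinearMap.comp_add, ih, h,
      vertexContraction_comp_self]
    abel

lemma simplicialBoundary_comp_self :
    simplicialBoundary k V ∘ₗ simplicialBoundary k V = 0 := by
  classical
  refine finsupp_linearMap_ext fun s => ?_
  rw [LinearMap.comp_apply, simplicialBoundary_single subset_rfl, map_sum]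
  have h : ∀ v ∈ s, simplicialBoundary k V (vertexContraction k v (Finsupp.single s 1)) =
      -∑ w ∈ s, vertexContraction k v (vertexContraction k w (Finsupp.single s 1)) := by
    intro v _
    have := LinearMap.congr_fun (simplicialBoundary_comp_vertexContraction (k := k) v)
      (Finsupp.single s 1)
    rw [LinearMap.comp_apply] at this
    rw [this, LinearMap.neg_apply, LinearMap.comp_apply, simplicialBoundary_single subset_rfl,
      map_sum]
  rw [Finset.sum_congr rfl h, Finset.sum_neg_distrib, neg_eq_zero.mpr, LinearMap.zero_apply]
  have := LinearMap.congr_fun (sum_vertexContraction_comp_self (k := k) s) (Finsupp.single s 1)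
  simpa [LinearMap.sum_apply, map_sum] using this

lemma simplicialBoundary_simplicialBoundary (z : Finset V →₀ k) :
    simplicialBoundary k V (simplicialBoundary k V z) = 0 :=
  LinearMap.congr_fun simplicialBoundary_comp_self z

lemma simplicialBoundary_vertexContraction (v : V) (z : Finset V →₀ k) :
    simplicialBoundary k V (vertexContraction k v z) =
      -vertexContraction k v (simplicialBoundary k V z) :=
  LinearMap.congr_fun (simplicialBoundary_comp_vertexContraction v) z

lemma simplicialBoundary_single_singleton (v : V) :
    simplicialBoundary k V (Finsupp.single {v} 1) = Finsupp.single ∅ 1 := by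
  classical
  rw [simplicialBoundary_single subset_rfl, Finset.sum_singleton,
    vertexContraction_single_of_mem (Finset.mem_singleton_self v), incidenceSign_singleton]
  simp

open scoped Classical in
lemma simplicialBoundary_mem_supported {A B : Set (Finset V)}
    (h : ∀ s ∈ A, ∀ v ∈ s, s.erase v ∈ B) {z : Finset V →₀ k}
    (hz : z ∈ Finsupp.supported k k A) :
    simplicialBoundary k V z ∈ Finsupp.supported k k B := by
  rw [simplicialBoundary, Finsupp.linearCombination_apply]
  exact Submodule.sum_mem _ fun s hs => Submodule.smul_mem _ _ <|
    Submodule.sum_mem _ fun v hv => Finsupp.single_mem_supported k _ (h s (hz hs) v hv)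

end Contraction

/-! ### Links, chains, and rigidity of top cycles -/

namespace PreAbstractSimplicialComplex

variable {k V : Type*} [Field k] {K L : PreAbstractSimplicialComplex V} {x s t : Finset V} {n i : ℤ}

lemma empty_mem_augFaces (K : PreAbstractSimplicialComplex V) : ∅ ∈ K.augFaces :=
  Set.mem_insert _ _

lemma mem_augFaces_iff_of_nonempty (hs : s.Nonempty) : s ∈ K.augFaces ↔ s ∈ K.faces :=
  ⟨fun h => h.resolve_left hs.ne_empty, Or.inr⟩

lemma augFaces_of_subset (hs : s ∈ K.augFaces) (hts : t ⊆ s) : t ∈ K.augFaces := by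
  rcases t.eq_empty_or_nonempty with rfl | ht
  · exact K.empty_mem_augFaces
  · exact Or.inr ((K.isRelLowerSet_faces
      ((mem_augFaces_iff_of_nonempty (ht.mono hts)).mp hs)).2 hts ht)

lemma augFaces_mono (h : K ≤ L) : K.augFaces ⊆ L.augFaces :=
  Set.insert_subset_insert h

open scoped Classical in
lemma mem_augFaces_link (hx : x ∈ K.augFaces) :
    s ∈ (K.link x).augFaces ↔ Disjoint s x ∧ s ∪ x ∈ K.augFaces := by
  rcases s.eq_empty_or_nonempty with rfl | hs
  · simpa [empty_mem_augFaces] using hx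
  · rw [mem_augFaces_iff_of_nonempty hs,
      mem_augFaces_iff_of_nonempty (hs.mono Finset.subset_union_left)]
    exact ⟨fun h => h.2, fun h => ⟨hs, h⟩⟩

lemma augFaces_link_mono (h : K ≤ L) : (K.link x).augFaces ⊆ (L.link x).augFaces := by
  refine augFaces_mono fun s hs => ?_
  exact ⟨hs.1, hs.2.1, h hs.2.2⟩

open scoped Classical in
lemma sdiff_mem_augFaces_link (ht : t ∈ K.augFaces) (hxt : x ⊆ t) :
    t \ x ∈ (K.link x).augFaces := by
  rw [mem_augFaces_link (augFaces_of_subset ht hxt), Finset.sdiff_union_of_subset hxt]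
  exact ⟨Finset.sdiff_disjoint, ht⟩

lemma HasRank.card_le (h : K.HasRank n) (hs : s ∈ K.augFaces) : (s.card : ℤ) ≤ n := by
  obtain ⟨t, _, hst, ht⟩ := h s hs
  have := Finset.card_le_card hst
  lia

lemma HasRank.link (h : K.HasRank n) (hx : x ∈ K.augFaces) :
    (K.link x).HasRank (n - x.card) := by
  classical
  intro s hs
  rw [mem_augFaces_link hx] at hs
  obtain ⟨t, ht, hst, htn⟩ := h _ hs.2
  have hxt : x ⊆ t := Finset.union_subset_right hst
  refine ⟨t \ x, sdiff_mem_augFaces_link ht hxt, ?_, ?_⟩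
  · exact Finset.subset_sdiff.mpr ⟨Finset.union_subset_left hst, hs.1⟩
  · rw [Finset.card_sdiff_of_subset hxt]
    have := Finset.card_le_card hxt
    lia

lemma mem_chains {z : Finset V →₀ k} :
    z ∈ K.chains k i ↔ ∀ s, z s ≠ 0 → s ∈ K.augFaces ∧ (s.card : ℤ) = i + 1 := by
  rw [chains, Finsupp.mem_supported]
  exact ⟨fun h s hs => h (Finsupp.mem_support_iff.mpr hs),
    fun h s hs => h s (Finsupp.mem_support_iff.mp hs)⟩

lemma single_mem_chains (hs : s ∈ K.augFaces) (hi : (s.card : ℤ) = i + 1) (a : k) :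
    Finsupp.single s a ∈ K.chains k i :=
  Finsupp.single_mem_supported k a ⟨hs, hi⟩

lemma chains_mono (h : K.augFaces ⊆ L.augFaces) : K.chains k i ≤ L.chains k i :=
  Finsupp.supported_mono fun _ hs => ⟨h hs.1, hs.2⟩

lemma cycles_mono (h : K.augFaces ⊆ L.augFaces) : K.cycles k i ≤ L.cycles k i :=
  inf_le_inf_right _ (chains_mono h)

lemma mem_cycles {z : Finset V →₀ k} :
    z ∈ K.cycles k i ↔ z ∈ K.chains k i ∧ simplicialBoundary k V z = 0 :=
  Iff.rfl

lemma simplicialBoundary_mem_chains {z : Finset V →₀ k} (hz : z ∈ K.chains k (i + 1)) :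
    simplicialBoundary k V z ∈ K.chains k i := by
  classical
  refine simplicialBoundary_mem_supported (fun s hs v hv => ?_) hz
  refine ⟨augFaces_of_subset hs.1 (s.erase_subset v), ?_⟩
  have := Finset.card_erase_add_one hv
  have := hs.2
  lia

lemma HasRank.eq_zero_of_mem_chains (h : K.HasRank n) (hi : n ≤ i) {z : Finset V →₀ k}
    (hz : z ∈ K.chains k i) : z = 0 := by
  ext s
  by_contra hs
  obtain ⟨h1, h2⟩ := mem_chains.mp hz s hs
  have := h.card_le h1
  lia

lemma HasRank.boundaries_eq_bot (h : K.HasRank n) (hi : n ≤ i + 1) : K.boundaries k i = ⊥ := by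
  rw [eq_bot_iff]
  rintro _ ⟨w, hw, rfl⟩
  rw [h.eq_zero_of_mem_chains hi hw, map_zero]
  exact zero_mem _

lemma subsingleton_reducedHomology_iff :
    Subsingleton (K.ReducedHomology k i) ↔ K.cycles k i ≤ K.boundaries k i := by
  rw [← Submodule.comap_subtype_eq_top]
  exact Submodule.Quotient.subsingleton_iff

/-- There are no boundaries in top degree, so homology is the space of cycles itself and classes
become actual chains. -/
lemma HasRank.exists_generator_cycles (h : K.HasRank n) (hi : n ≤ i + 1)
    (e : Nonempty (K.ReducedHomology k i ≃ₗ[k] k)) :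
    ∃ ζ ∈ K.cycles k i, ζ ≠ 0 ∧ ∀ z ∈ K.cycles k i, ∃ c : k, z = c • ζ := by
  obtain ⟨e⟩ := e
  have hb : (K.boundaries k i).submoduleOf (K.cycles k i) = ⊥ := by
    rw [h.boundaries_eq_bot hi, Submodule.submoduleOf, Submodule.comap_bot, Submodule.ker_subtype]
  let f : K.cycles k i ≃ₗ[k] k := (Submodule.quotEquivOfEqBot _ hb).symm.trans e
  refine ⟨f.symm 1, (f.symm 1).2, fun h0 => ?_, fun z hz => ⟨f ⟨z, hz⟩, ?_⟩⟩
  · have : f.symm 1 = 0 := Subtype.ext h0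
    simp at this
  · have : (⟨z, hz⟩ : K.cycles k i) = f ⟨z, hz⟩ • f.symm 1 := by
      rw [← map_smul, smul_eq_mul, mul_one, f.symm_apply_apply]
    exact congrArg Subtype.val this

lemma HasRank.eq_zero_of_mem_cycles (h : K.HasRank n) (hi : n ≤ i + 1)
    (hH : Subsingleton (K.ReducedHomology k i)) {z : Finset V →₀ k} (hz : z ∈ K.cycles k i) :
    z = 0 := by
  have := subsingleton_reducedHomology_iff.mp hH hz
  rwa [h.boundaries_eq_bot hi] at this

open scoped Classical in
/-- If the reduced homology in degree `0` vanishes, then the graph of the complex is connected. -/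
lemma singleton_mem_of_adj_closed (hH : Subsingleton (K.ReducedHomology k 0)) {S : Set V}
    (hS : ∀ v ∈ S, ∀ w, w ≠ v → {v, w} ∈ K.augFaces → w ∈ S) {v w : V} (hv : v ∈ S)
    (hvK : {v} ∈ K.augFaces) (hwK : {w} ∈ K.augFaces) : w ∈ S := by
  by_contra hw
  have hz : Finsupp.single {w} 1 - Finsupp.single {v} (1 : k) ∈ K.cycles k 0 := by
    refine mem_cycles.mpr ⟨sub_mem (single_mem_chains hwK (by simp) _)
      (single_mem_chains hvK (by simp) _), ?_⟩
    rw [map_sub, simplicialBoundary_single_singleton, simplicialBoundary_single_singleton, sub_self]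
  obtain ⟨c, hc, hcz⟩ := subsingleton_reducedHomology_iff.mp hH hz
  -- An edge not contained in `S` has both ends outside `S`, so the boundaries of the two parts have
  -- disjoint supports and `∂ c₁ = -{v}`.
  set c₁ : Finset V →₀ k := c.filter fun s => (s : Set V) ⊆ S
  set c₂ : Finset V →₀ k := c.filter fun s => ¬ (s : Set V) ⊆ S
  have hcc : c₁ + c₂ = c := Finsupp.filter_add_filter_not _ _
  have h₁ : simplicialBoundary k V c₁ ∈ Finsupp.supported k k {s : Finset V | (s : Set V) ⊆ S} := by
    refine simplicialBoundary_mem_supported (A := {s : Finset V | (s : Set V) ⊆ S})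
      (B := {s : Finset V | (s : Set V) ⊆ S}) (fun s hs v _ => fun u hu => hs (Finset.mem_of_mem_erase hu)) ?_
    intro s hs
    have hs' := Finsupp.mem_support_iff.mp hs
    by_contra hn
    exact hs' (Finsupp.filter_apply_neg _ _ hn)
  have h₂ : simplicialBoundary k V c₂ ∈
      Finsupp.supported k k {s : Finset V | ¬ (s : Set V) ⊆ S} := by
    refine simplicialBoundary_mem_supported (A := {s : Finset V | ¬ (s : Set V) ⊆ S ∧
      s ∈ K.augFaces ∧ (s.card : ℤ) = 0 + 1 + 1}) (fun s hs u hu => ?_) ?_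
    · intro hsub
      obtain ⟨a, ha⟩ : ∃ a, s.erase u = {a} := by
        rw [← Finset.card_eq_one, Finset.card_erase_of_mem hu]
        have := hs.2.2
        lia
      have hau : u ≠ a := by
        rintro rfl
        exact s.notMem_erase u (ha ▸ Finset.mem_singleton_self u)
      have hs' : s = {a, u} := by
        rw [← Finset.insert_erase hu, ha, Finset.pair_comm]
      have haS : a ∈ S := hsub (by rw [ha]; simp)
      refine hs.1 ?_
      have huS := hS a haS u hau (hs' ▸ hs.2.1)
      rw [hs']
      rintro b hb
      rcases Finset.mem_insert.mp hb with rfl | hb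
      · exact haS
      · rwa [Finset.mem_singleton.mp hb]
    · intro s hs
      have hs' := Finsupp.mem_support_iff.mp hs
      have hn : ¬ (s : Set V) ⊆ S := fun hn => hs' (Finsupp.filter_apply_neg _ _ (not_not.mpr hn))
      have : c s ≠ 0 := by rwa [← Finsupp.filter_apply_pos (fun s : Finset V => ¬ ((s : Set V) ⊆ S)) c hn]
      exact ⟨hn, mem_chains.mp hc s this⟩
  have hsum : simplicialBoundary k V c₁ + simplicialBoundary k V c₂ =
      Finsupp.single {w} 1 - Finsupp.single {v} (1 : k) := by
    rw [← map_add, hcc, hcz]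
  have hc₁ : simplicialBoundary k V c₁ = - Finsupp.single {v} (1 : k) := by
    ext s
    have hs := DFunLike.congr_fun hsum s
    simp only [Finsupp.add_apply, Finsupp.sub_apply] at hs
    by_cases hsS : (s : Set V) ⊆ S
    · have h0 : simplicialBoundary k V c₂ s = 0 := by
        by_contra hne
        exact h₂ (Finsupp.mem_support_iff.mpr hne) hsS
      have h1 : ({w} : Finset V) ≠ s := by
        rintro rfl
        exact hw (hsS (by simp))
      rw [h0, add_zero, Finsupp.single_eq_of_ne' h1, zero_sub] at hs
      exact hs
    · have h0 : simplicialBoundary k V c₁ s = 0 := by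
        by_contra hne
        exact hsS (h₁ (Finsupp.mem_support_iff.mpr hne))
      have h1 : ({v} : Finset V) ≠ s := by
        rintro rfl
        exact hsS (by simpa using hv)
      rw [h0, Finsupp.neg_apply, Finsupp.single_eq_of_ne' h1, neg_zero]
  have h0 := simplicialBoundary_simplicialBoundary c₁
  rw [hc₁, map_neg, simplicialBoundary_single_singleton] at h0
  -- The augmentation of `-{v}` is `-∅`, which is nonzero, while `∂ ∂ c₁ = 0`.
  simp at h0

open scoped Classical in
/-- On a homology sphere, every nonzero cycle of top degree in the link of a face is supported on
all facets of the link. -/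
lemma IsGorenstein.apply_ne_zero_of_mem_cycles (hK : K.IsGorenstein k n) (m : ℕ) :
    ∀ x ∈ K.augFaces, (x.card : ℤ) + m = n → ∀ z ∈ (K.link x).cycles k (m - 1), z ≠ 0 →
      ∀ s ∈ (K.link x).augFaces, s.card = m → z s ≠ 0 := by
  induction m with
  | zero =>
    -- In degree `-1` the empty face is the only simplex available.
    intro x hx hm z hz hz0 s hs hsm hzs
    refine hz0 (Finsupp.ext fun t => ?_)
    by_contra ht
    have h := (mem_chains.mp hz.1 t ht).2
    have : t = s := by
      rw [Finset.card_eq_zero.mp hsm, ← Finset.card_eq_zero]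
      lia
    exact ht (this ▸ hzs)
  | succ m ih =>
    intro x hx hm z hz hz0 s hs hsm hzs
    have hcyc : ∀ v, {v} ∈ (K.link x).augFaces → insert v x ∈ K.augFaces ∧ v ∉ x ∧
        vertexContraction k v z ∈ (K.link (insert v x)).cycles k (m - 1) := by
      intro v hv
      rw [mem_augFaces_link hx, Finset.disjoint_singleton_left, Finset.singleton_union] at hv
      refine ⟨hv.2, hv.1, mem_cycles.mpr ⟨?_, ?_⟩⟩
      · refine vertexContraction_mem_supported (fun t ht hvt => ?_) hz.1
        have ht1 := (mem_augFaces_link hx).mp ht.1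
        refine ⟨(mem_augFaces_link hv.2).mpr ⟨?_, ?_⟩, ?_⟩
        · rw [Finset.disjoint_insert_right]
          exact ⟨t.notMem_erase v, Finset.disjoint_of_subset_left (t.erase_subset v) ht1.1⟩
        · rw [Finset.union_insert, ← Finset.insert_union, Finset.insert_erase hvt]
          exact ht1.2
        · have := Finset.card_erase_add_one hvt
          have := ht.2
          push_cast at this
          lia
      · rw [simplicialBoundary_vertexContraction, (mem_cycles.mp hz).2, map_zero, neg_zero]
    have hfull : ∀ v t, t ∈ (K.link x).augFaces → t.card = m + 1 → v ∈ t →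
        vertexContraction k v z ≠ 0 → z t ≠ 0 := by
      intro v t ht htm hvt hne
      obtain ⟨h1, h2, h3⟩ := hcyc v (augFaces_of_subset ht (by simpa using hvt))
      have htx := (mem_augFaces_link hx).mp ht
      have := ih (insert v x) h1 (by rw [Finset.card_insert_of_notMem h2]; push_cast at hm ⊢; lia)
        _ h3 hne (t.erase v) ((mem_augFaces_link h1).mpr ⟨?_, ?_⟩)
        (by rw [Finset.card_erase_of_mem hvt, htm]; rfl)
      · rw [vertexContraction_apply_erase z hvt] at this
        exact right_ne_zero_of_mul this
      · rw [Finset.disjoint_insert_right]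
        exact ⟨t.notMem_erase v, Finset.disjoint_of_subset_left (t.erase_subset v) htx.1⟩
      · rw [Finset.union_insert, ← Finset.insert_union, Finset.insert_erase hvt]
        exact htx.2
    have hcontr : ∀ v t, v ∈ t → z t ≠ 0 → vertexContraction k v z ≠ 0 := by
      intro v t hvt ht h0
      have := vertexContraction_apply_erase z hvt
      rw [h0, Finsupp.zero_apply] at this
      exact mul_ne_zero (incidenceSign_ne_zero t v) ht this.symm
    obtain ⟨t, ht⟩ := Finsupp.ne_iff.mp hz0
    rw [Finsupp.zero_apply] at ht
    obtain ⟨htK, htm⟩ := mem_chains.mp hz.1 t ht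
    have htm' : t.card = m + 1 := by push_cast at htm; lia
    obtain ⟨w, hw⟩ : s.Nonempty := Finset.card_pos.mp (by lia)
    obtain ⟨v, hv⟩ : t.Nonempty := Finset.card_pos.mp (by lia)
    have hwK : {w} ∈ (K.link x).augFaces := augFaces_of_subset hs (by simpa using hw)
    have hvK : {v} ∈ (K.link x).augFaces := augFaces_of_subset htK (by simpa using hv)
    have hrank := hK.hasRank.link hx
    -- The link has dimension `m`. In dimension `0` it is not connected; there the
    -- one-dimensionality of the cycle space is used. If `z` vanishes at `w` but not at `v`, so does
    -- the generator, yet `{w} - {v}` must be a multiple of it.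
    rcases Nat.eq_zero_or_pos m with rfl | hmpos
    · obtain ⟨ζ, -, -, hgen⟩ := hrank.exists_generator_cycles (i := 0) (k := k) (by lia)
        (hK.homology_top x hx 0 (by lia))
      have hs1 : s = {w} := ((Finset.card_eq_one.mp hsm).elim fun a ha => by
        rw [ha] at hw ⊢; rw [Finset.mem_singleton.mp hw])
      have ht1 : t = {v} := ((Finset.card_eq_one.mp htm').elim fun a ha => by
        rw [ha] at hv ⊢; rw [Finset.mem_singleton.mp hv])
      subst hs1 ht1
      have hne : ({v} : Finset V) ≠ {w} := by
        intro h; rw [h] at ht; exact ht hzs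
      have hz' : Finsupp.single {w} 1 - Finsupp.single {v} (1 : k) ∈ (K.link x).cycles k 0 := by
        refine mem_cycles.mpr ⟨sub_mem (single_mem_chains hwK (by simp) _)
          (single_mem_chains hvK (by simp) _), ?_⟩
        rw [map_sub, simplicialBoundary_single_singleton, simplicialBoundary_single_singleton,
          sub_self]
      obtain ⟨a, ha⟩ := hgen _ hz'
      obtain ⟨b, hb⟩ := hgen z (by simpa using hz)
      rw [hb] at hzs ht
      have hζ : ζ {w} = 0 := by
        refine (mul_eq_zero.mp hzs).resolve_left ?_
        rintro rfl
        simp at ht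
      have := DFunLike.congr_fun ha {w}
      simp [hζ, hne.symm] at this
    · have hmem := singleton_mem_of_adj_closed (hK.homology_zero x hx 0 (by push_cast at hm; lia))
        (S := {v | vertexContraction k v z ≠ 0}) ?_ (hcontr v t hv ht) hvK hwK
      · exact hfull w s hs hsm hw hmem hzs
      -- An edge `{a, b}` extends to a facet `u`; nonvanishing at `a` gives `z u ≠ 0`, hence
      -- nonvanishing at `b`.
      · intro a ha b _ hab
        obtain ⟨u, hu, habu, hucard⟩ := hrank _ hab
        have hum : u.card = m + 1 := by push_cast at hm; lia
        exact hcontr b u (habu (by simp)) (hfull a u hu hum (habu (by simp)) ha)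

end PreAbstractSimplicialComplex

/-! ### The complement of a homology ball in a homology sphere -/

namespace PreAbstractSimplicialComplex

variable {k V : Type*} [Field k] {K K₁ K₂ B : PreAbstractSimplicialComplex V} {x y s t : Finset V}
  {n i : ℤ}

/-- A homology sphere has no proper subcomplexes carrying a nonzero top cycle: if `z` is such a
cycle in the link of a face `x`, then every face containing `x` lies in the union of `x` with a
simplex of `z`. -/
lemma IsGorenstein.exists_facet_apply_ne_zero (hK : K.IsGorenstein k n) (hx : x ∈ K.augFaces)
    {z : Finset V →₀ k} (hz : z ∈ (K.link x).cycles k (n - 1 - x.card)) (hz0 : z ≠ 0)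
    (hy : y ∈ (K.link x).augFaces) : ∃ t, y ⊆ t ∧ z t ≠ 0 := by
  obtain ⟨t, ht, hyt, htn⟩ := hK.hasRank.link hx y hy
  refine ⟨t, hyt, hK.apply_ne_zero_of_mem_cycles t.card x hx (by lia) z ?_ hz0 t ht rfl⟩
  convert hz using 2
  lia

/-- The link of `x` in `K₁` has a nonzero top cycle, which is also a top cycle of the link in `K`.
By rigidity its simplices, all in `K₁`, cover the link of `x` in `K`. -/
lemma IsNearGorenstein.mem_interior_of_subset (h₁ : K₁.IsNearGorenstein k B n)
    (hK : K.IsGorenstein k n) (hle : K₁ ≤ K) (hx : x ∈ K₁.interior B) (hxy : x ⊆ y)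
    (hy : y ∈ K.augFaces) : y ∈ K₁.interior B := by
  classical
  refine ⟨?_, fun hyB => hx.2 (augFaces_of_subset hyB hxy)⟩
  have hxK := augFaces_of_subset hy hxy
  obtain ⟨ζ, hζ, hζ0, -⟩ := (h₁.hasRank.link hx.1).exists_generator_cycles
    (i := n - 1 - x.card) (by lia) (h₁.homology_top x hx.1 _ ⟨rfl, hx.2⟩)
  obtain ⟨t, hyt, ht⟩ := hK.exists_facet_apply_ne_zero hxK
    (cycles_mono (augFaces_link_mono hle) hζ) hζ0 (sdiff_mem_augFaces_link hy hxy)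
  have ht' := ((mem_augFaces_link hx.1).mp (mem_chains.mp hζ.1 t ht).1).2
  refine augFaces_of_subset ht' ?_
  rw [← Finset.sdiff_union_of_subset hxy]
  exact Finset.union_subset_union_left hyt

lemma IsNearGorenstein.exists_complement (h₁ : K₁.IsNearGorenstein k B n)
    (hK : K.IsGorenstein k n) (hle : K₁ ≤ K) :
    ∃ K₂ : PreAbstractSimplicialComplex V, K₂.augFaces = K.augFaces \ K₁.interior B := by
  refine ⟨⟨K.faces \ K₁.interior B, ?_⟩, ?_⟩
  · rintro s ⟨hs, hs'⟩
    obtain ⟨hne, hlow⟩ := K.isRelLowerSet_faces hs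
    exact ⟨hne, fun t hts ht => ⟨hlow hts ht, fun hint =>
      hs' (h₁.mem_interior_of_subset hK hle hint hts (Or.inr hs))⟩⟩
  · ext s
    simp only [augFaces, Set.mem_insert_iff, Set.mem_sdiff]
    refine ⟨?_, fun h => h.1.imp_right fun h' => ⟨h', h.2⟩⟩
    rintro (rfl | h)
    · exact ⟨Or.inl rfl, fun h => h.2 B.empty_mem_augFaces⟩
    · exact ⟨Or.inr h.1, h.2⟩

lemma eq_of_augFaces_eq (h : K₁.augFaces = K₂.augFaces) : K₁ = K₂ := by
  ext s
  constructor <;> intro hs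
  · have hne := (K₁.isRelLowerSet_faces hs).1
    rwa [← mem_augFaces_iff_of_nonempty hne, ← h, mem_augFaces_iff_of_nonempty hne]
  · have hne := (K₂.isRelLowerSet_faces hs).1
    rwa [← mem_augFaces_iff_of_nonempty hne, h, mem_augFaces_iff_of_nonempty hne]

lemma le_of_augFaces_subset (h : K₁.augFaces ⊆ K₂.augFaces) : K₁ ≤ K₂ := by
  intro s hs
  have hne := (K₁.isRelLowerSet_faces hs).1
  exact (mem_augFaces_iff_of_nonempty hne).mp (h (Or.inr hs))

/-- Chains of a union of two subcomplexes split into chains of the subcomplexes. -/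
lemma exists_add_of_mem_chains (h : K.augFaces ⊆ K₁.augFaces ∪ K₂.augFaces) {z : Finset V →₀ k}
    (hz : z ∈ K.chains k i) : ∃ z₁ ∈ K₁.chains k i, ∃ z₂ ∈ K₂.chains k i, z₁ + z₂ = z := by
  have : z ∈ K₁.chains k i ⊔ K₂.chains k i := by
    rw [chains, chains, ← Finsupp.supported_union]
    refine Finsupp.supported_mono (fun s hs => ?_) hz
    exact (h hs.1).imp (fun h => ⟨h, hs.2⟩) (fun h => ⟨h, hs.2⟩)
  obtain ⟨z₁, h₁, z₂, h₂, h₃⟩ := Submodule.mem_sup.mp this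
  exact ⟨z₁, h₁, z₂, h₂, h₃⟩

lemma mem_chains_of_mem_inter (h : K₁.augFaces ∩ K₂.augFaces ⊆ B.augFaces) {z : Finset V →₀ k}
    (h₁ : z ∈ K₁.chains k i) (h₂ : z ∈ K₂.chains k i) : z ∈ B.chains k i :=
  mem_chains.mpr fun s hs =>
    ⟨h ⟨(mem_chains.mp h₁ s hs).1, (mem_chains.mp h₂ s hs).1⟩, (mem_chains.mp h₁ s hs).2⟩

/-- The consequence of the Mayer–Vietoris sequence for a homology sphere `K` that is the union of
an acyclic complex `K₁` and a complex `K₂` without top cycles, which intersect in a homology sphere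
`B` of codimension one: `K₂` is acyclic. -/
lemma subsingleton_reducedHomology_of_union
    (h₂ : K₂.augFaces ⊆ K.augFaces) (hB : B.augFaces ⊆ K₂.augFaces)
    (hunion : K.augFaces ⊆ K₁.augFaces ∪ K₂.augFaces)
    (hinter : K₁.augFaces ∩ K₂.augFaces ⊆ B.augFaces)
    (hK : K.HasRank n) (hK₁ : K₁.HasRank n) (hBn : B.HasRank (n - 1))
    (hKtop : Nonempty (K.ReducedHomology k (n - 1) ≃ₗ[k] k))
    (hKzero : ∀ i ≠ n - 1, Subsingleton (K.ReducedHomology k i))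
    (hBtop : Nonempty (B.ReducedHomology k (n - 2) ≃ₗ[k] k))
    (hBzero : ∀ i ≠ n - 2, Subsingleton (B.ReducedHomology k i))
    (hK₁zero : ∀ i, Subsingleton (K₁.ReducedHomology k i))
    (hK₂top : ∀ z ∈ K₂.cycles k (n - 1), z = 0) (i : ℤ) :
    Subsingleton (K₂.ReducedHomology k i) := by
  rw [subsingleton_reducedHomology_iff]
  intro z hz
  rcases eq_or_ne i (n - 1) with rfl | hi
  · rw [hK₂top z hz]
    exact zero_mem _
  obtain ⟨w, hw, hwz⟩ := subsingleton_reducedHomology_iff.mp (hKzero i hi) (cycles_mono h₂ hz)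
  obtain ⟨w₁, hw₁, w₂, hw₂, rfl⟩ := exists_add_of_mem_chains hunion hw
  rw [map_add] at hwz
  -- This is the Mayer–Vietoris connecting map: `∂ w₁ = z - ∂ w₂` lies in both pieces.
  have hu : simplicialBoundary k V w₁ ∈ B.cycles k i := by
    refine mem_cycles.mpr ⟨mem_chains_of_mem_inter hinter (simplicialBoundary_mem_chains hw₁) ?_,
      simplicialBoundary_simplicialBoundary _⟩
    rw [eq_sub_of_add_eq hwz]
    exact sub_mem hz.1 (simplicialBoundary_mem_chains hw₂)
  rcases ne_or_eq i (n - 2) with hi' | rfl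
  · obtain ⟨u, hu, huw⟩ := subsingleton_reducedHomology_iff.mp (hBzero i hi') hu
    refine ⟨u + w₂, add_mem (chains_mono hB hu) hw₂, ?_⟩
    rw [map_add, huw, hwz]
  · obtain ⟨ζ, hζ, hζ0, -⟩ := hK.exists_generator_cycles (by lia) hKtop
    obtain ⟨η, hη, -, hgen⟩ := hBn.exists_generator_cycles (by lia) hBtop
    obtain ⟨ζ₁, hζ₁, ζ₂, hζ₂, rfl⟩ := exists_add_of_mem_chains hunion hζ.1
    have hsum := (mem_cycles.mp hζ).2
    rw [map_add] at hsum
    have hn : n - 2 + 1 = n - 1 := by ring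
    have hζB : simplicialBoundary k V ζ₁ ∈ B.cycles k (n - 2) := by
      refine mem_cycles.mpr ⟨mem_chains_of_mem_inter hinter
        (simplicialBoundary_mem_chains (by rwa [hn])) ?_, simplicialBoundary_simplicialBoundary _⟩
      rw [eq_neg_of_add_eq_zero_left hsum]
      exact neg_mem (simplicialBoundary_mem_chains (by rwa [hn]))
    -- Otherwise the fundamental cycle would split into top cycles of `K₁` and `K₂`, both zero.
    have hne : simplicialBoundary k V ζ₁ ≠ 0 := by
      intro h0
      rw [h0, zero_add] at hsum
      have e₁ := hK₁.eq_zero_of_mem_cycles (by lia) (hK₁zero (n - 1)) (mem_cycles.mpr ⟨hζ₁, h0⟩)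
      have e₂ := hK₂top ζ₂ (mem_cycles.mpr ⟨hζ₂, hsum⟩)
      exact hζ0 (by rw [e₁, e₂, add_zero])
    obtain ⟨a, ha⟩ := hgen _ hu
    obtain ⟨b, hb⟩ := hgen _ hζB
    have hb0 : b ≠ 0 := by
      rintro rfl
      exact hne (by rw [hb, zero_smul])
    -- `∂ w₁ = a η` and `∂ ζ₁ = b η = -∂ ζ₂`, so `∂ w₁` is the boundary of `-(a / b) ζ₂` in `K₂`.
    refine ⟨w₂ - (a / b) • ζ₂, sub_mem hw₂ (Submodule.smul_mem _ _ (by rwa [hn])), ?_⟩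
    rw [map_sub, map_smul, eq_neg_of_add_eq_zero_right hsum, ← hwz, ha, hb, smul_neg, smul_smul,
      div_mul_cancel₀ _ hb0]
    abel

/-- The complement of a homology ball in a homology sphere of the same dimension is a homology ball
with the same boundary. -/
theorem IsNearGorenstein.complement (h₁ : K₁.IsNearGorenstein k B n) (hK : K.IsGorenstein k n)
    (hle : K₁ ≤ K) (h₂ : K₂.augFaces = K.augFaces \ K₁.interior B) :
    K₂.IsNearGorenstein k B n := by
  classical
  have hBK₁ := augFaces_mono h₁.boundary_le
  have hK₁K := augFaces_mono hle
  have hK₂K : K₂.augFaces ⊆ K.augFaces := h₂ ▸ Set.sdiff_subset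
  have hBK₂ : B.augFaces ⊆ K₂.augFaces := fun s hs => by
    rw [h₂]
    exact ⟨hK₁K (hBK₁ hs), fun h => h.2 hs⟩
  have hinter : ∀ s ∈ K₁.augFaces, s ∈ K₂.augFaces → s ∈ B.augFaces := by
    intro s hs₁ hs₂
    rw [h₂] at hs₂
    by_contra hsB
    exact hs₂.2 ⟨hs₁, hsB⟩
  have hunion : ∀ s ∈ K.augFaces, s ∈ K₁.augFaces ∨ s ∈ K₂.augFaces := by
    intro s hs
    by_cases hs₁ : s ∈ K₁.augFaces
    · exact Or.inl hs₁
    · rw [h₂]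
      exact Or.inr ⟨hs, fun h => hs₁ h.1⟩
  -- Such an `x` is not in `K₁`, so no face containing it is.
  have hlink : ∀ x ∈ K₂.augFaces, x ∉ B.augFaces → K₂.link x = K.link x := by
    intro x hx hxB
    refine eq_of_augFaces_eq (Set.ext fun s => ?_)
    rw [mem_augFaces_link hx, mem_augFaces_link (hK₂K hx)]
    refine and_congr_right fun _ => ⟨fun h => hK₂K h, fun h => (hunion _ h).resolve_left fun h' => ?_⟩
    exact hxB (hinter x (augFaces_of_subset h' Finset.subset_union_right) hx)
  -- The links of boundary faces in the complement have no top cycles.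
  have htop : ∀ x ∈ B.augFaces, ∀ z ∈ (K₂.link x).cycles k (n - 1 - x.card), z = 0 := by
    intro x hx z hz
    by_contra hz0
    obtain ⟨t, ht, hxt, htn⟩ := h₁.hasRank x (hBK₁ hx)
    obtain ⟨u, hu, hzu⟩ := hK.exists_facet_apply_ne_zero (hK₁K (hBK₁ hx))
      (cycles_mono (fun s hs => (mem_augFaces_link (hK₁K (hBK₁ hx))).mpr
        (((mem_augFaces_link (hBK₂ hx)).mp hs).imp_right fun h => hK₂K h)) hz) hz0
      (sdiff_mem_augFaces_link (hK₁K ht) hxt)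
    have hu' := ((mem_augFaces_link (hBK₂ hx)).mp (mem_chains.mp hz.1 u hzu).1).2
    have htK₂ : t ∈ K₂.augFaces := by
      refine augFaces_of_subset hu' ?_
      rw [← Finset.sdiff_union_of_subset hxt]
      exact Finset.union_subset_union_left hu
    have := h₁.boundary_isGorenstein.hasRank.card_le (hinter t ht htK₂)
    lia
  refine ⟨?_, le_of_augFaces_subset hBK₂, h₁.boundary_isGorenstein, ?_, ?_⟩
  · intro x hx
    by_cases hxB : x ∈ B.augFaces
    -- If no `n`-vertex face of `K₂` contains `x`, the fundamental cycle of the link in `K` lives in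
    -- `K₁`, where top homology at a boundary face vanishes.
    · by_contra! hcon
      obtain ⟨ζ, hζ, hζ0, -⟩ := (hK.hasRank.link (hK₂K hx)).exists_generator_cycles
        (i := n - 1 - x.card) (by lia) (hK.homology_top x (hK₂K hx) _ rfl)
      refine hζ0 ((h₁.hasRank.link (hBK₁ hxB)).eq_zero_of_mem_cycles (i := n - 1 - x.card) (by lia)
        (h₁.homology_zero x (hBK₁ hxB) _ fun h => h.2 hxB) (mem_cycles.mpr ⟨?_, hζ.2⟩))
      refine mem_chains.mpr fun s hs => ?_
      obtain ⟨hsK, hsn⟩ := mem_chains.mp hζ.1 s hs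
      rw [mem_augFaces_link (hK₂K hx)] at hsK
      refine ⟨(mem_augFaces_link (hBK₁ hxB)).mpr ⟨hsK.1, ?_⟩, hsn⟩
      refine (hunion _ hsK.2).resolve_right fun h => hcon _ h Finset.subset_union_right ?_
      rw [Finset.card_union_of_disjoint hsK.1]
      push_cast
      lia
    · obtain ⟨t, ht, hxt, htn⟩ := hK.hasRank x (hK₂K hx)
      exact ⟨t, (hunion t ht).resolve_left fun h => hxB (hinter x (augFaces_of_subset h hxt) hx),
        hxt, htn⟩
  · rintro x hx i ⟨hi, hxB⟩
    rw [hlink x hx hxB]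
    exact hK.homology_top x (hK₂K hx) i hi
  · intro x hx i hi
    by_cases hxB : x ∈ B.augFaces
    · have hx₁ := hBK₁ hxB
      have hxK := hK₂K hx
      refine subsingleton_reducedHomology_of_union (K := K.link x) (K₁ := K₁.link x)
        (K₂ := K₂.link x) (B := B.link x) (n := n - x.card) ?_ ?_ ?_ ?_ (hK.hasRank.link hxK)
        (h₁.hasRank.link hx₁) ?_ (hK.homology_top x hxK _ (by ring))
        (fun i hi => hK.homology_zero x hxK _ (by lia))
        (h₁.boundary_isGorenstein.homology_top x hxB _ (by ring))
        (fun i hi => h₁.boundary_isGorenstein.homology_zero x hxB _ (by lia))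
        (fun i => h₁.homology_zero x hx₁ i fun h => h.2 hxB) ?_ i
      · exact augFaces_link_mono (le_of_augFaces_subset hK₂K)
      · exact augFaces_link_mono (le_of_augFaces_subset hBK₂)
      · intro s hs
        rw [mem_augFaces_link hxK] at hs
        exact (hunion _ hs.2).imp (fun h => (mem_augFaces_link hx₁).mpr ⟨hs.1, h⟩)
          (fun h => (mem_augFaces_link hx).mpr ⟨hs.1, h⟩)
      · rintro s ⟨hs₁, hs₂⟩
        rw [mem_augFaces_link hx₁] at hs₁
        rw [mem_augFaces_link hx] at hs₂
        exact (mem_augFaces_link hxB).mpr ⟨hs₁.1, hinter _ hs₁.2 hs₂.2⟩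
      · convert h₁.boundary_isGorenstein.hasRank.link hxB using 1
        ring
      · intro z hz
        refine htop x hxB z ?_
        convert hz using 2
        ring
    · rw [hlink x hx hxB]
      exact hK.homology_zero x (hK₂K hx) i fun h => hi ⟨h, hxB⟩

end PreAbstractSimplicialComplex

/-! ### Order complexes and Gorenstein* posets -/

section OrderComplex

open PreAbstractSimplicialComplex

variable {P : Type*} [PartialOrder P] [OrderBot P] {S Q B : Set P} {s t : Finset P} {a b : P}
  {n : ℕ} {g : P → ℕ}

lemma mem_augFaces_orderComplex :
    s ∈ (orderComplex S).augFaces ↔ (s : Set P) ⊆ S ∧ ⊥ ∉ s ∧ IsChain (· ≤ ·) (s : Set P) := by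
  rcases s.eq_empty_or_nonempty with rfl | hs
  · simp [empty_mem_augFaces]
  · rw [mem_augFaces_iff_of_nonempty hs]
    exact ⟨fun h => h.2, fun h => ⟨hs, h⟩⟩

lemma orderComplex_mono (h : S ⊆ Q) : orderComplex S ≤ orderComplex Q :=
  fun _ hs => ⟨hs.1, hs.2.1.trans h, hs.2.2⟩

lemma singleton_mem_augFaces_orderComplex (ha : a ∈ S) (hbot : a ≠ ⊥) :
    {a} ∈ (orderComplex S).augFaces :=
  mem_augFaces_orderComplex.mpr ⟨by simpa using ha, by simpa using hbot.symm, by simp⟩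

open scoped Classical in
lemma union_mem_augFaces_orderComplex (hs : s ∈ (orderComplex S).augFaces)
    (ht : t ∈ (orderComplex S).augFaces) (h : ∀ b ∈ s, ∀ c ∈ t, b ≤ c) :
    s ∪ t ∈ (orderComplex S).augFaces := by
  rw [mem_augFaces_orderComplex] at hs ht ⊢
  rw [Finset.coe_union]
  refine ⟨Set.union_subset hs.1 ht.1, by simp [hs.2.1, ht.2.1], ?_⟩
  exact isChain_union.mpr ⟨hs.2.2, ht.2.2, fun b hb c hc _ => Or.inl (h b hb c hc)⟩

omit [OrderBot P] in
lemma StrictMono.injOn_of_isChain (hg : StrictMono g) (hs : IsChain (· ≤ ·) (s : Set P)) :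
    Set.InjOn g s := by
  intro b hb c hc hbc
  by_contra hne
  rcases hs.total hb hc with h | h
  · exact (hg (lt_of_le_of_ne h hne)).ne hbc
  · exact (hg (lt_of_le_of_ne h (Ne.symm hne))).ne hbc.symm

lemma StrictMono.pos_of_ne_bot (hg : StrictMono g) (ha : a ≠ ⊥) : 0 < g a :=
  (Nat.zero_le _).trans_lt (hg (bot_lt_iff_ne_bot.mpr ha))

open scoped Classical in
-- The chain omits `⊥`, so grades of its elements below `a` are distinct and lie between `1` and `g
-- a - 1`.
lemma card_filter_lt_lt (hg : StrictMono g) (hs : s ∈ (orderComplex S).augFaces) (ha : a ≠ ⊥) :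
    (s.filter (· < a)).card < g a := by
  obtain ⟨-, hbot, hc⟩ := mem_augFaces_orderComplex.mp hs
  have h := Finset.card_le_card_of_injOn (s := s.filter (· < a)) (t := Finset.Ico 1 (g a)) g ?_
    ((hg.injOn_of_isChain hc).mono (Finset.coe_subset.mpr (Finset.filter_subset _ _)))
  · rw [Nat.card_Ico] at h
    have := hg.pos_of_ne_bot ha
    lia
  · intro b hb
    rw [Finset.coe_filter] at hb
    rw [Finset.coe_Ico]
    exact ⟨hg.pos_of_ne_bot fun h => hbot (h ▸ hb.1), hg hb.2⟩

open scoped Classical in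
lemma card_filter_le_add_le (hg : StrictMono g) (hgn : ∀ p, g p ≤ n)
    (hs : s ∈ (orderComplex S).augFaces) : (s.filter (a ≤ ·)).card + g a ≤ n + 1 := by
  obtain ⟨-, hbot, hc⟩ := mem_augFaces_orderComplex.mp hs
  have h := Finset.card_le_card_of_injOn (s := s.filter (a ≤ ·)) (t := Finset.Icc (g a) n) g ?_
    ((hg.injOn_of_isChain hc).mono (Finset.coe_subset.mpr (Finset.filter_subset _ _)))
  · rw [Nat.card_Icc] at h
    have := hgn a
    lia
  · intro b hb
    rw [Finset.coe_filter] at hb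
    rw [Finset.coe_Icc]
    exact ⟨hg.monotone hb.2, hgn b⟩

open scoped Classical in
lemma card_filter_lt_add_card_filter_le (hs : s ∈ (orderComplex S).augFaces) (ha : a ∈ s) :
    (s.filter (· < a)).card + (s.filter (a ≤ ·)).card = s.card := by
  obtain ⟨-, -, hc⟩ := mem_augFaces_orderComplex.mp hs
  rw [← Finset.card_filter_add_card_filter_not (s := s) (p := (· < a))]
  congr 2
  refine Finset.filter_congr fun b hb => ⟨fun h => h.not_gt, fun h => ?_⟩
  rcases hc.total ha hb with h' | h'
  · exact h'
  · exact (eq_of_le_of_not_lt h' h).ge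

lemma exists_mem_eq_of_card_eq (hg : StrictMono g) (hgn : ∀ p, g p ≤ n)
    (hs : s ∈ (orderComplex S).augFaces) (hsn : s.card = n) {j : ℕ} (hj : 1 ≤ j) (hjn : j ≤ n) :
    ∃ c ∈ s, g c = j := by
  classical
  obtain ⟨-, hbot, hc⟩ := mem_augFaces_orderComplex.mp hs
  have himage : s.image g = Finset.Icc 1 n := by
    refine Finset.eq_of_subset_of_card_le ?_ ?_
    · intro j hj
      obtain ⟨c, hc, rfl⟩ := Finset.mem_image.mp hj
      exact Finset.mem_Icc.mpr ⟨hg.pos_of_ne_bot fun h => hbot (h ▸ hc), hgn c⟩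
    · rw [Finset.card_image_of_injOn (hg.injOn_of_isChain hc), Nat.card_Icc]
      lia
  exact Finset.mem_image.mp (himage ▸ Finset.mem_Icc.mpr ⟨hj, hjn⟩)

/-- If the order complex of a subset `S` of a graded poset of rank `n` has rank `n`, then `S` is
graded of rank `n` by the grade of the ambient poset. -/
lemma isPosetOfRank_of_hasRank (hg : StrictMono g) (hgn : ∀ p, g p ≤ n) (hg0 : g ⊥ = 0)
    (hbot : ⊥ ∈ S) (hS : (orderComplex S).HasRank n) : IsPosetOfRank S n := by
  classical
  have hfacet : ∀ a ∈ S, ∀ b ∈ S, a ≤ b → ∀ j, 1 ≤ j → j ≤ n →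
      ∃ c ∈ S, g c = j ∧ (a ≤ c ∨ c ≤ a) ∧ (b ≤ c ∨ c ≤ b) := by
    intro a ha b hb hab j hj hjn
    -- Faces omit `⊥`, which is comparable with everything anyway; a facet containing the rest meets
    -- every grade from `1` to `n`.
    have hmem : ({a, b} : Finset P).erase ⊥ ∈ (orderComplex S).augFaces := by
      refine mem_augFaces_orderComplex.mpr ⟨fun c hc => ?_, Finset.notMem_erase _ _,
        IsChain.mono (t := {a, b}) (fun c hc => ?_) (IsChain.pair hab)⟩
      · rcases Finset.mem_insert.mp (Finset.mem_of_mem_erase hc) with rfl | hc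
        · exact ha
        · rwa [Finset.mem_singleton.mp hc]
      · simpa using Finset.mem_of_mem_erase hc
    obtain ⟨F, hF, hsub, hFn⟩ := hS _ hmem
    obtain ⟨c, hcF, hcj⟩ := exists_mem_eq_of_card_eq hg hgn hF (by exact_mod_cast hFn) hj hjn
    obtain ⟨hFS, -, hFc⟩ := mem_augFaces_orderComplex.mp hF
    have hcomp : ∀ d ∈ ({a, b} : Finset P), d ≤ c ∨ c ≤ d := by
      intro d hd
      rcases eq_or_ne d ⊥ with rfl | hd'
      · exact Or.inl bot_le
      · exact hFc.total (hsub (Finset.mem_erase.mpr ⟨hd', hd⟩)) hcF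
    exact ⟨c, hFS hcF, hcj, hcomp a (by simp), hcomp b (by simp)⟩
  refine ⟨hbot, { grade := fun a => g a, grade_strictMono := ?_, covBy_grade := ?_,
                  isMin_grade := ?_ }, ?_⟩
  · exact fun a b hab => hg hab
  · intro a b hab
    have hlt : a.1 < b.1 := hab.lt
    have hglt := hg hlt
    by_contra hcov
    have hgap : g a + 1 < g b := lt_of_le_of_ne hglt fun h => hcov (Nat.covBy_iff_add_one_eq.mpr h)
    have := hgn b
    obtain ⟨c, hcS, hcg, hca, hcb⟩ := hfacet a a.2 b b.2 hlt.le (g a + 1) (by lia) (by lia)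
    have hac : a.1 < c := by
      rcases hca with h | h
      · exact lt_of_le_of_ne h fun he => by rw [← he] at hcg; lia
      · have := hg.monotone h; lia
    have hcb' : c < b.1 := by
      rcases hcb with h | h
      · have := hg.monotone h; lia
      · exact lt_of_le_of_ne h fun he => by rw [he] at hcg; lia
    exact hab.2 (c := ⟨c, hcS⟩) hac hcb'
  · intro a ha
    have : a.1 = ⊥ := le_bot_iff.mp (ha (b := ⟨⊥, hbot⟩) bot_le)
    rw [this, hg0]
    exact isMin_bot
  · intro a ha
    change (g a : ℤ) = n
    have hle := hgn a
    rcases Nat.eq_zero_or_pos n with h0 | hn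
    · lia
    obtain ⟨c, hcS, hcg, hca, -⟩ := hfacet a a.2 a a.2 le_rfl n hn le_rfl
    have hca' : c ≤ a.1 := hca.elim (fun h => ha (b := ⟨c, hcS⟩) h) id
    have := hg.monotone hca'
    lia

lemma IsPosetOfRank.exists_grade [Finite P] (h : IsPosetOfRank (Set.univ : Set P) n) :
    ∃ g : P → ℕ, StrictMono g ∧ (∀ p, g p ≤ n) ∧ g ⊥ = 0 := by
  obtain ⟨-, hgrade, hmax⟩ := h
  have hmono : StrictMono fun p : P => grade ℕ (⟨p, trivial⟩ : (Set.univ : Set P)) :=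
    fun p q hpq => grade_strictMono (𝕆 := ℕ) (α := (Set.univ : Set P)) hpq
  refine ⟨_, hmono, fun p => ?_, ?_⟩
  · obtain ⟨m, hpm, hm⟩ := Finite.exists_le_maximal (p := fun _ : P => True) (a := p) trivial
    have hm' : grade ℕ (⟨m, trivial⟩ : (Set.univ : Set P)) = n := by
      have := hmax ⟨m, trivial⟩ fun q hq => hm.2 trivial hq
      exact_mod_cast this
    exact (hmono.monotone hpm).trans hm'.le
  · have hmin : IsMin (⟨⊥, trivial⟩ : (Set.univ : Set P)) := fun q _ => bot_le (a := q.1)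
    exact Nat.eq_zero_of_le_zero ((hmin.grade ℕ) (Nat.zero_le _))

open scoped Classical in
/-- The boundary of a near-Gorenstein* subposet of a Gorenstein* poset is an ideal of the whole
poset. -/
lemma IsNearGorensteinStar.mem_boundary_of_lt (hg : StrictMono g) (hgn : ∀ p, g p ≤ n)
    (hP : (orderComplex (Set.univ : Set P)).IsGorenstein ℝ n) (hQ : IsNearGorensteinStar Q B n)
    (ha : a ∈ B) (hba : b < a) : b ∈ B := by
  have ha0 : a ≠ ⊥ := (bot_le.trans_lt hba).ne'
  rcases eq_or_ne b ⊥ with rfl | hb0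
  · exact hQ.boundary_isPosetOfRank.1
  have hBrank := hQ.isNearGorenstein.boundary_isGorenstein.hasRank
  obtain ⟨F, hF, haF, hFn⟩ := hQ.isNearGorenstein.hasRank {a}
    (singleton_mem_augFaces_orderComplex (hQ.boundary_subset ha) ha0)
  rw [Finset.singleton_subset_iff] at haF
  obtain ⟨hFQ, hFbot, hFc⟩ := mem_augFaces_orderComplex.mp hF
  have hF1 := card_filter_lt_lt hg hF ha0
  have hF2 := card_filter_le_add_le (a := a) hg hgn hF
  have hF3 := card_filter_lt_add_card_filter_le hF haF
  have hlow : F.filter (· < a) ∈ (orderComplex B).augFaces := by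
    refine mem_augFaces_orderComplex.mpr ⟨fun c hc => ?_, fun h => hFbot (Finset.mem_filter.mp h).1,
      hFc.mono (Finset.coe_subset.mpr (Finset.filter_subset _ _))⟩
    rw [Finset.coe_filter] at hc
    exact hQ.boundary_ideal a ha c (hFQ hc.1) hc.2
  obtain ⟨G, hG, hsub, hGn⟩ := hBrank _ (union_mem_augFaces_orderComplex hlow
    (singleton_mem_augFaces_orderComplex ha ha0) fun c hc d hd => by
      rw [Finset.mem_singleton.mp hd]
      exact (Finset.mem_filter.mp hc).2.le)
  have haG : a ∈ G := hsub (by simp)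
  have hG1 := card_filter_lt_lt hg hG ha0
  have hG3 := card_filter_lt_add_card_filter_le hG haG
  have hG4 : (F.filter (· < a)).card ≤ (G.filter (· < a)).card := by
    refine Finset.card_le_card fun c hc => Finset.mem_filter.mpr ⟨hsub ?_, (Finset.mem_filter.mp hc).2⟩
    exact Finset.mem_union_left _ hc
  -- The bounds force `g a - 1` elements below `a` in both `F` and `G`, so `y.card = x.card + 1`.
  -- The links of `x` in `B` and of `y` in `P` thus have the same top degree, `g a - 2`.
  set x := G.filter (a ≤ ·) with hx_def
  set y := F.filter (a ≤ ·) with hy_def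
  have hx : x ∈ (orderComplex B).augFaces := augFaces_of_subset hG (Finset.filter_subset _ _)
  have hax : a ∈ x := Finset.mem_filter.mpr ⟨haG, le_rfl⟩
  have hy : y ∈ (orderComplex (Set.univ : Set P)).augFaces :=
    augFaces_mono (orderComplex_mono (Set.subset_univ Q))
      (augFaces_of_subset hF (Finset.filter_subset _ _))
  have hlink : ∀ s ∈ (orderComplex (Set.univ : Set P)).augFaces, (∀ c ∈ s, c < a) →
      s ∈ ((orderComplex (Set.univ : Set P)).link y).augFaces := by
    intro s hs hsa
    refine (mem_augFaces_link hy).mpr ⟨?_, union_mem_augFaces_orderComplex hs hy ?_⟩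
    · exact Finset.disjoint_left.mpr fun c hcs hcy =>
        (hsa c hcs).not_ge (Finset.mem_filter.mp hcy).2
    · exact fun c hc d hd => (hsa c hc).le.trans (Finset.mem_filter.mp hd).2
  obtain ⟨z, hz, hz0, -⟩ := (hBrank.link hx).exists_generator_cycles
    (i := (n : ℤ) - 1 - 1 - x.card) (by lia)
    (hQ.isNearGorenstein.boundary_isGorenstein.homology_top x hx _ rfl)
  have hzB : ∀ s, z s ≠ 0 → Disjoint s x ∧ s ∪ x ∈ (orderComplex B).augFaces :=
    fun s hs => (mem_augFaces_link hx).mp (mem_chains.mp hz.1 s hs).1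
  have hza : ∀ s, z s ≠ 0 → ∀ c ∈ s, c < a := by
    intro s hs c hcs
    obtain ⟨hsx, hsB⟩ := hzB s hs
    have hcx : c ∉ x := Finset.disjoint_left.mp hsx hcs
    have hchain := (mem_augFaces_orderComplex.mp hsB).2.2
    rcases hchain.total (Finset.mem_coe.mpr (Finset.mem_union_left _ hcs))
      (Finset.mem_coe.mpr (Finset.mem_union_right _ hax)) with h | h
    · exact lt_of_le_of_ne h fun he => hcx (he ▸ hax)
    · exfalso
      -- Together with the `g a - 1` elements of `F` below `a`, this would be a chain of `n`
      -- elements in `B`, which has rank `n - 1`.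
      have hins : insert c x ∈ (orderComplex B).augFaces := by
        refine augFaces_of_subset hsB (Finset.insert_subset ?_ Finset.subset_union_right)
        exact Finset.mem_union_left _ hcs
      have hge : ∀ d ∈ insert c x, a ≤ d := by
        intro d hd
        rcases Finset.mem_insert.mp hd with rfl | hd
        · exact h
        · exact (Finset.mem_filter.mp hd).2
      have hbig := hBrank.card_le (union_mem_augFaces_orderComplex hlow hins fun d hd e he =>
        (Finset.mem_filter.mp hd).2.le.trans (hge e he))
      rw [Finset.card_union_of_disjoint (Finset.disjoint_left.mpr fun d hd hd' =>
        (Finset.mem_filter.mp hd).2.not_ge (hge d hd')), Finset.card_insert_of_notMem hcx] at hbig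
      push_cast at hbig
      lia
  -- All simplices of `z` are chains below `a`, so they also lie in the link of `y`; by rigidity
  -- some simplex of `z`, a chain in `B`, contains `b`.
  have hzP : z ∈ ((orderComplex (Set.univ : Set P)).link y).cycles ℝ (n - 1 - y.card) := by
    refine mem_cycles.mpr ⟨mem_chains.mpr fun s hs => ⟨hlink s ?_ (hza s hs), ?_⟩, hz.2⟩
    · exact augFaces_mono (orderComplex_mono (Set.subset_univ B))
        (augFaces_of_subset (hzB s hs).2 Finset.subset_union_left)
    · have := (mem_chains.mp hz.1 s hs).2
      lia
  obtain ⟨t, hbt, ht⟩ := hP.exists_facet_apply_ne_zero hy hzP hz0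
    (hlink {b} (singleton_mem_augFaces_orderComplex trivial hb0) (by simpa using hba))
  exact (mem_augFaces_orderComplex.mp (hzB t ht).2).1
    (Finset.mem_coe.mpr (Finset.mem_union_left _ (Finset.singleton_subset_iff.mp hbt)))

/-- The complement of a near-Gorenstein* subposet in a Gorenstein* poset of the same rank is
near-Gorenstein* with the same boundary. -/
theorem IsNearGorensteinStar.complement [Finite P] (hP : IsGorensteinStar (Set.univ : Set P) n)
    (hQ : IsNearGorensteinStar Q B n) :
    IsNearGorensteinStar (Set.univ \ (Q \ B)) B n := by
  obtain ⟨g, hg, hgn, hg0⟩ := hP.isPosetOfRank.exists_grade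
  have hle : orderComplex Q ≤ orderComplex Set.univ := orderComplex_mono (Set.subset_univ Q)
  have hBR : B ⊆ Set.univ \ (Q \ B) := fun a ha => ⟨trivial, fun h => h.2 ha⟩
  have hfaces : (orderComplex (Set.univ \ (Q \ B))).augFaces =
      (orderComplex (Set.univ : Set P)).augFaces \
        (orderComplex Q).interior (orderComplex B) := by
    ext s
    refine ⟨fun hs => ⟨augFaces_mono (orderComplex_mono (Set.subset_univ _)) hs, fun hint => ?_⟩,
      fun hs => ?_⟩
    · rw [mem_augFaces_orderComplex] at hs
      have hsQ := (mem_augFaces_orderComplex.mp hint.1).1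
      refine hint.2 (mem_augFaces_orderComplex.mpr ⟨fun a ha => ?_, hs.2⟩)
      by_contra haB
      exact (hs.1 ha).2 ⟨hsQ ha, haB⟩
    · obtain ⟨-, hbot, hc⟩ := mem_augFaces_orderComplex.mp hs.1
      refine mem_augFaces_orderComplex.mpr ⟨fun a ha => ⟨trivial, fun haQ => hs.2 ?_⟩, hbot, hc⟩
      -- A chain through `a ∈ Q \ B` contains the interior face `{a}`, so it is interior.
      refine hQ.isNearGorenstein.mem_interior_of_subset hP.isGorenstein hle (x := {a})
        ⟨singleton_mem_augFaces_orderComplex haQ.1 fun h => hbot (h ▸ ha), fun haB => ?_⟩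
        (by simpa using ha) hs.1
      exact haQ.2 ((mem_augFaces_orderComplex.mp haB).1 (by simp))
  have hnear := hQ.isNearGorenstein.complement hP.isGorenstein hle hfaces
  exact {
    isPosetOfRank :=
      isPosetOfRank_of_hasRank hg hgn hg0 (hBR hQ.boundary_isPosetOfRank.1) hnear.hasRank
    boundary_isPosetOfRank := hQ.boundary_isPosetOfRank
    boundary_subset := hBR
    boundary_ideal := fun a ha b _ hba => hQ.mem_boundary_of_lt hg hgn hP.isGorenstein ha hba
    isNearGorenstein := hnear }

end OrderComplex

end

theorem mainTheorem9 :
    (∀ {V : Type*} (Δ Δ₁ B : PreAbstractSimplicialComplex V) (n : ℕ),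
      Δ.faces.Finite → Δ.IsGorenstein ℝ n → Δ₁ ≤ Δ → Δ₁.IsNearGorenstein ℝ B n →
        ∃ Δ₂ : PreAbstractSimplicialComplex V,
          Δ₂.augFaces = Δ.augFaces \ Δ₁.interior B ∧
          Δ₂.IsNearGorenstein ℝ B n) ∧
    (∀ {P : Type*} [PartialOrder P] [OrderBot P] [Finite P] (Q B : Set P) (n : ℕ),
      IsGorensteinStar (Set.univ : Set P) n → IsNearGorensteinStar Q B n →
        IsNearGorensteinStar (Set.univ \ (Q \ B)) B n) := by
  refine ⟨fun Δ Δ₁ B n _ hΔ hle h₁ => ?_, fun Q B n hP hQ => hQ.complement hP⟩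
  obtain ⟨Δ₂, h₂⟩ := h₁.exists_complement hΔ hle
  exact ⟨Δ₂, h₂, h₁.complement hΔ hle h₂⟩
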